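/- Arithmetic terms in a variable $n$ ranging over $\mathbb N=\{0,1,2,\dots\}$ are defined inductively: every constant $c\in\mathbb N$ and the variable $n$ are arithmetic terms, and if $t_1,t_2$ are arithmetic terms, then so are $(t_1+t_2)$, $(t_1\mathbin{\dot-}t_2)$, $(t_1\cdot t_2)$, $\lfloor t_1/t_2\rfloor$ and $2^{t_1}$, where $x\mathbin{\dot-}y=\max\{x-y,0\}$. Theorem. There is an arithmetic term $\mathcal T(n)$ in the single variable $n$ such that, for every $n\in\mathbb N$, the evaluation of $\mathcal T(n)$ involves no division by zero and its value is exactly the number of prime numbers $p$ with $0<p\le n$ such that $p+2$ is prime. -/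

import Mathlib

/-- Arithmetic terms in the variables `n₀, …, n₍ₘ₋₁₎`: the expressions built from the constants in `ℕ`
and the variables with `t₁ + t₂`, `t₁ ∸ t₂`, `t₁ * t₂`, `⌊t₁ / t₂⌋` and `2 ^ t`. -/
inductive ArithTerm (m : ℕ) : Type
  | const (c : ℕ) : ArithTerm m
  | var (i : Fin m) : ArithTerm m
  | add (t₁ t₂ : ArithTerm m) : ArithTerm m
  | monus (t₁ t₂ : ArithTerm m) : ArithTerm m
  | mul (t₁ t₂ : ArithTerm m) : ArithTerm m
  | div (t₁ t₂ : ArithTerm m) : ArithTerm m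
  | twoPow (t : ArithTerm m) : ArithTerm m

namespace ArithTerm

/-- The value of an arithmetic term. Subtraction of natural numbers is the modified subtraction
`max (x - y) 0`, and division of natural numbers is the integer part of the quotient. -/
def eval {m : ℕ} (v : Fin m → ℕ) : ArithTerm m → ℕ
  | const c => c
  | var i => v i
  | add t₁ t₂ => eval v t₁ + eval v t₂
  | monus t₁ t₂ => eval v t₁ - eval v t₂
  | mul t₁ t₂ => eval v t₁ * eval v t₂
  | div t₁ t₂ => eval v t₁ / eval v t₂
  | twoPow t => 2 ^ eval v t

/-- No subterm requires a division by zero when the term is evaluated at `v`. -/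
def DefinedAt {m : ℕ} (v : Fin m → ℕ) : ArithTerm m → Prop
  | const _ => True
  | var _ => True
  | add t₁ t₂ => DefinedAt v t₁ ∧ DefinedAt v t₂
  | monus t₁ t₂ => DefinedAt v t₁ ∧ DefinedAt v t₂
  | mul t₁ t₂ => DefinedAt v t₁ ∧ DefinedAt v t₂
  | div t₁ t₂ => DefinedAt v t₁ ∧ DefinedAt v t₂ ∧ eval v t₂ ≠ 0
  | twoPow t => DefinedAt v t

end ArithTerm

/-!
The functions `ℕ → ℕ` computed by everywhere defined arithmetic terms (`IsTerm`) are closed under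
much more than the five basic operations, and the twin prime counting function is reached by
composing the following closure properties. Everything rests on packing many small numbers into the
digits of one large number.

*Counting ones.* Powers `x ^ y` are residues of powers of `2`. In a sum `∑ z ^ e s` with fewer than
`z` summands, the digit of index `k` in base `z` counts the `s` with `e s = k` (`sum_pow_div_mod`);
applied to `(1 + z) ^ n` and to a product of two geometric sums, this gives binomial coefficients
and greatest common divisors. By Kummer's theorem the number of binary ones of `m` is the exponent
of `2` in `(2 * m).choose m`. The corresponding power of `2` is a greatest common divisor, and its
exponent is recovered from `(1 + N) ^ v = 1 + v * N` modulo `N ^ 2`. Hence `IsTerm.popcount`.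

*Counting zeros.* For `1 ≤ v ≤ 2 ^ u` the number `v * (2 ^ u - 1)` has exactly `u` binary ones, and
for `v = 0` it has none. So the number of nonzero digits in base `2 ^ (2 * u)` of a number with
digits at most `2 ^ u` is given by a term (`popcount_sum_mul`). Sums of `x ^ e * 2 ^ (s * x)` over an
interval have closed forms, and so have the sums of exponential polynomials over boxes. Packing all
values of a nonnegative exponential polynomial into one number, one counts its zeros in a box
(`IsExpPoly.isTerm_card_zeros`).

*Twin primes.* Let `G p` be the number of pairs `(a, b)` such that `(a + 2) * (b + 2)` is `p` or
`p + 2`. Apart from `0` and `1`, the zeros of `G` are the primes `p` with `p + 2` prime. The packed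
number `∑ p ≤ n, G p * z ^ p` is itself a number of zeros, namely of
`(a + 2) * (b + 2) ∈ {p, p + 2}`, `j + s + 1 = z ^ p` in a box of side `z ^ n`
(`card_witnessPoly_zeros`), and its zero digits are counted by counting ones once more.
-/

open Finset

/-! ### Functions computed by arithmetic terms -/

/-- The functions `ℕ → ℕ` computed by an arithmetic term in one variable whose evaluation never
divides by zero. -/
def IsTerm (f : ℕ → ℕ) : Prop :=
  ∃ T : ArithTerm 1, ∀ n : ℕ, T.DefinedAt (fun _ => n) ∧ T.eval (fun _ => n) = f n

namespace IsTerm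

variable {f g h : ℕ → ℕ}

theorem const (c : ℕ) : IsTerm fun _ => c := ⟨.const c, fun _ => ⟨trivial, rfl⟩⟩

theorem id : IsTerm fun n => n := ⟨.var 0, fun _ => ⟨trivial, rfl⟩⟩

theorem add (hf : IsTerm f) (hg : IsTerm g) : IsTerm fun n => f n + g n := by
  obtain ⟨S, hS⟩ := hf
  obtain ⟨T, hT⟩ := hg
  exact ⟨.add S T, fun n => ⟨⟨(hS n).1, (hT n).1⟩, by simp [ArithTerm.eval, (hS n).2, (hT n).2]⟩⟩

theorem sub (hf : IsTerm f) (hg : IsTerm g) : IsTerm fun n => f n - g n := by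
  obtain ⟨S, hS⟩ := hf
  obtain ⟨T, hT⟩ := hg
  exact ⟨.monus S T, fun n => ⟨⟨(hS n).1, (hT n).1⟩, by simp [ArithTerm.eval, (hS n).2, (hT n).2]⟩⟩

theorem mul (hf : IsTerm f) (hg : IsTerm g) : IsTerm fun n => f n * g n := by
  obtain ⟨S, hS⟩ := hf
  obtain ⟨T, hT⟩ := hg
  exact ⟨.mul S T, fun n => ⟨⟨(hS n).1, (hT n).1⟩, by simp [ArithTerm.eval, (hS n).2, (hT n).2]⟩⟩

theorem two_pow (hf : IsTerm f) : IsTerm fun n => 2 ^ f n := by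
  obtain ⟨S, hS⟩ := hf
  exact ⟨.twoPow S, fun n => ⟨(hS n).1, by simp [ArithTerm.eval, (hS n).2]⟩⟩

theorem div_of_ne_zero (hf : IsTerm f) (hg : IsTerm g) (h0 : ∀ n, g n ≠ 0) :
    IsTerm fun n => f n / g n := by
  obtain ⟨S, hS⟩ := hf
  obtain ⟨T, hT⟩ := hg
  exact ⟨.div S T, fun n => ⟨⟨(hS n).1, (hT n).1, by simpa [(hT n).2] using h0 n⟩,
    by simp [ArithTerm.eval, (hS n).2, (hT n).2]⟩⟩

/-- Division with the convention `x / 0 = 0` is available without any hypothesis on the divisor: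
`x / y = (1 ∸ (1 ∸ y)) * ⌊x / (y + (1 ∸ y))⌋`, where the new divisor never vanishes. -/
theorem div (hf : IsTerm f) (hg : IsTerm g) : IsTerm fun n => f n / g n := by
  have key := ((const 1).sub ((const 1).sub hg)).mul
    (hf.div_of_ne_zero (hg.add ((const 1).sub hg)) fun n => by omega)
  convert key using 2 with n
  rcases Nat.eq_zero_or_pos (g n) with h | h
  · simp [h]
  · have : 1 - g n = 0 := by omega
    simp [this]

theorem mod (hf : IsTerm f) (hg : IsTerm g) : IsTerm fun n => f n % g n := by
  convert hf.sub (hg.mul (hf.div hg)) using 2 with n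
  have := Nat.div_add_mod (f n) (g n)
  omega

theorem pow_const (hf : IsTerm f) (e : ℕ) : IsTerm fun n => f n ^ e := by
  induction e with
  | zero => simpa using const 1
  | succ e ih => simpa only [pow_succ] using ih.mul hf

theorem sum {ι : Type*} (s : Finset ι) {F : ι → ℕ → ℕ} (hF : ∀ i ∈ s, IsTerm (F i)) :
    IsTerm fun n => ∑ i ∈ s, F i n := by
  classical
  induction s using Finset.induction_on with
  | empty => simpa using const 0
  | insert a s ha ih =>
    simp only [Finset.sum_insert ha]
    exact (hF a (by simp)).add (ih fun i hi => hF i (by simp [hi]))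

theorem prod {ι : Type*} (s : Finset ι) {F : ι → ℕ → ℕ} (hF : ∀ i ∈ s, IsTerm (F i)) :
    IsTerm fun n => ∏ i ∈ s, F i n := by
  classical
  induction s using Finset.induction_on with
  | empty => simpa using const 1
  | insert a s ha ih =>
    simp only [Finset.prod_insert ha]
    exact (hF a (by simp)).mul (ih fun i hi => hF i (by simp [hi]))

end IsTerm

/-! ### Powers, binomial coefficients and greatest common divisors -/

/-- Exponentiation from powers of `2`: `2 ^ w` is congruent to `x` modulo `2 ^ w - x`, so
`2 ^ (w * y)` is congruent to `x ^ y`, and `w` is chosen so large that `x ^ y` is already reduced. -/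
theorem two_pow_mod_eq_pow (x y : ℕ) :
    2 ^ ((x * y + x + 1) * y) % (2 ^ (x * y + x + 1) - x) = x ^ y := by
  set w := x * y + x + 1 with hw
  have hx : x < 2 ^ x := Nat.lt_two_pow_self
  have h1 : x ^ y ≤ 2 ^ (x * y) := by
    rw [pow_mul]
    exact Nat.pow_le_pow_left hx.le _
  have h2 : 2 ^ w = 2 * (2 ^ (x * y) * 2 ^ x) := by
    rw [hw, pow_succ, pow_add]; ring
  have h3 : 1 ≤ 2 ^ (x * y) := Nat.one_le_two_pow
  have h5 : 2 ^ (x * y) + x < 2 ^ w := by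
    rw [h2]
    nlinarith
  have h4 : x ^ y < 2 ^ w - x := by omega
  have h6 : 2 ^ w ≡ x [MOD 2 ^ w - x] := by
    have : 2 ^ w = x + (2 ^ w - x) := by omega
    conv_lhs => rw [this]
    simp [Nat.ModEq]
  have h7 := h6.pow y
  rw [← pow_mul] at h7
  rw [h7, Nat.mod_eq_of_lt h4]

theorem IsTerm.pow {f g : ℕ → ℕ} (hf : IsTerm f) (hg : IsTerm g) :
    IsTerm fun n => f n ^ g n := by
  have hw := ((hf.mul hg).add hf).add (const 1)
  convert ((hw.mul hg).two_pow).mod (hw.two_pow.sub hf) using 2 with n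
  exact (two_pow_mod_eq_pow _ _).symm

/-- Reading off a coefficient: if `S` has fewer than `z` elements, the digit of index `k` in base
`z` of `∑ s ∈ S, z ^ e s` is the number of `s ∈ S` with `e s = k`. -/
theorem sum_pow_div_mod {ι : Type*} (S : Finset ι) (e : ι → ℕ) (z k : ℕ) (hz : #S < z) :
    (∑ s ∈ S, z ^ e s) / z ^ k % z = #{s ∈ S | e s = k} := by
  have hz0 : 0 < z := by omega
  have hsplit : ∑ s ∈ S, z ^ e s =
      ∑ s ∈ S with e s < k, z ^ e s + z ^ k * (#{s ∈ S | e s = k} +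
        z * ∑ s ∈ S with k < e s, z ^ (e s - k - 1)) := by
    rw [← Finset.sum_filter_add_sum_filter_not S (fun s => e s < k), mul_add]
    congr 1
    rw [← Finset.sum_filter_add_sum_filter_not _ (fun s => e s = k), Finset.filter_filter,
      Finset.filter_filter]
    congr 1
    · rw [Finset.filter_congr (q := fun s => e s = k) (by intro s _; omega),
        Finset.sum_congr rfl (g := fun _ => z ^ k) (by simp +contextual), Finset.sum_const,
        smul_eq_mul, mul_comm]
    · rw [Finset.filter_congr (q := fun s => k < e s) (by intro s _; omega), Finset.mul_sum,
        Finset.mul_sum]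
      refine Finset.sum_congr rfl fun s hs => ?_
      have : k < e s := (Finset.mem_filter.1 hs).2
      rw [← pow_succ', ← pow_add]
      congr 1
      omega
  have hlow : ∑ s ∈ S with e s < k, z ^ e s < z ^ k := by
    rcases Nat.eq_zero_or_pos k with rfl | hk
    · simp
    calc ∑ s ∈ S with e s < k, z ^ e s ≤ ∑ s ∈ S with e s < k, z ^ (k - 1) :=
          Finset.sum_le_sum fun s hs => Nat.pow_le_pow_right hz0 (by
            have := (Finset.mem_filter.1 hs).2
            omega)
      _ = #{s ∈ S | e s < k} * z ^ (k - 1) := by simp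
      _ < z * z ^ (k - 1) := Nat.mul_lt_mul_of_pos_right
          ((Finset.card_filter_le _ _).trans_lt hz) (by positivity)
      _ = z ^ k := by rw [← pow_succ', Nat.sub_add_cancel hk]
  rw [hsplit, Nat.add_mul_div_left _ _ (by positivity), Nat.div_eq_of_lt hlow, zero_add,
    Nat.add_mul_mod_self_left, Nat.mod_eq_of_lt ((Finset.card_filter_le _ _).trans_lt hz)]

/-- A binomial coefficient is a coefficient of `(1 + z) ^ n`. -/
theorem choose_eq_pow_div_mod (n k : ℕ) :
    (1 + 2 ^ (n + 1)) ^ n / (2 ^ (n + 1)) ^ k % 2 ^ (n + 1) = n.choose k := by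
  have h := sum_pow_div_mod (Finset.range n).powerset Finset.card (2 ^ (n + 1)) k
    (by simp [Nat.pow_lt_pow_right])
  have h1 : ∑ s ∈ (Finset.range n).powerset, (2 ^ (n + 1)) ^ #s = (1 + 2 ^ (n + 1)) ^ n := by
    have := Finset.sum_pow_mul_eq_add_pow (2 ^ (n + 1)) 1 (Finset.range n)
    simp only [one_pow, mul_one, Finset.card_range] at this
    rw [this, add_comm]
  rw [h1] at h
  rw [h, ← Finset.powersetCard_eq_filter, Finset.card_powersetCard, Finset.card_range]

theorem IsTerm.choose {f g : ℕ → ℕ} (hf : IsTerm f) (hg : IsTerm g) :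
    IsTerm fun n => (f n).choose (g n) := by
  have hz := (hf.add (const 1)).two_pow
  convert ((((const 1).add hz).pow hf).div (hz.pow hg)).mod hz using 2 with n
  exact (choose_eq_pow_div_mod _ _).symm

/-- `gcd a b` counts the lattice points of a half-open segment: with `a = g a'` and `b = g b'`, the
solutions of `a i + b (j + 1) = a b` are `i = b' t`, `j + 1 = a' (g - t)` for `t < g`. -/
theorem card_filter_mul_add_mul_eq (a b : ℕ) (ha : 0 < a) (hb : 0 < b) :
    #{p ∈ range b ×ˢ range a | a * p.1 + b * (p.2 + 1) = a * b} = Nat.gcd a b := by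
  have hg : 0 < Nat.gcd a b := Nat.gcd_pos_of_pos_left _ ha
  obtain ⟨a', b', hco, ha', hb'⟩ := Nat.exists_coprime a b
  generalize Nat.gcd a b = g at *
  subst ha' hb'
  have hpa : 0 < a' := Nat.pos_of_mul_pos_right ha
  have hpb : 0 < b' := Nat.pos_of_mul_pos_right hb
  conv_rhs => rw [← card_range g]
  symm
  refine card_bij (fun t _ => (b' * t, a' * (g - t) - 1)) ?_ ?_ ?_
  · intro t ht
    have ht : t < g := mem_range.1 ht
    obtain ⟨r, rfl⟩ := Nat.exists_eq_add_of_lt ht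
    have e1 : t + r + 1 - t = r + 1 := by omega
    have e2 : a' * (r + 1) - 1 + 1 = a' * (r + 1) :=
      Nat.sub_add_cancel (Nat.mul_pos hpa (Nat.succ_pos r))
    have e3 : a' * (r + 1) ≤ a' * (t + r + 1) := Nat.mul_le_mul_left _ (by omega)
    simp only [mem_filter, mem_product, mem_range, e1, e2]
    refine ⟨⟨?_, ?_⟩, by ring⟩
    · exact Nat.mul_lt_mul_of_pos_left ht hpb
    · omega
  · intro s _ t _ hst
    exact Nat.eq_of_mul_eq_mul_left hpb (Prod.ext_iff.1 hst).1
  · rintro ⟨i, j⟩ hij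
    simp only [mem_filter, mem_product, mem_range] at hij
    obtain ⟨⟨hi, hj⟩, h⟩ := hij
    have h1 : a' * i + b' * (j + 1) = a' * (b' * g) := by
      refine Nat.eq_of_mul_eq_mul_left hg ?_
      linarith
    have h2 : b' ∣ a' * i := by
      have h3 : b' ∣ a' * i + b' * (j + 1) := h1 ▸ ⟨a' * g, by ring⟩
      exact (Nat.dvd_add_left ⟨_, rfl⟩).1 h3
    obtain ⟨t, rfl⟩ := hco.symm.dvd_of_dvd_mul_left h2
    have ht : t < g := Nat.lt_of_mul_lt_mul_left hi
    refine ⟨t, mem_range.2 ht, ?_⟩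
    obtain ⟨r, rfl⟩ := Nat.exists_eq_add_of_lt ht
    have e1 : t + r + 1 - t = r + 1 := by omega
    have h4 : j + 1 = a' * (r + 1) := by
      refine Nat.eq_of_mul_eq_mul_left hpb ?_
      linarith
    simp only [e1, ← h4, Nat.add_sub_cancel]

/-- With `z = 2 ^ (a b)`, the product of the geometric sums `∑ z ^ (a i)`, `i < b`, and
`∑ z ^ (b (j + 1))`, `j < a`, has `gcd a b` as its coefficient of index `a b` in base `z`. -/
theorem geom_sum_mul_div_mod_eq_gcd (a b : ℕ) (ha : 0 < a) (hb : 0 < b) :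
    (((2 ^ (a * b)) ^ a) ^ b - 1) / ((2 ^ (a * b)) ^ a - 1) *
      ((2 ^ (a * b)) ^ b * ((((2 ^ (a * b)) ^ b) ^ a - 1) / ((2 ^ (a * b)) ^ b - 1))) /
        (2 ^ (a * b)) ^ (a * b) % 2 ^ (a * b) = Nat.gcd a b := by
  have h := sum_pow_div_mod (range b ×ˢ range a) (fun p => a * p.1 + b * (p.2 + 1)) (2 ^ (a * b))
    (a * b) (by simpa [mul_comm] using Nat.lt_two_pow_self)
  rw [card_filter_mul_add_mul_eq a b ha hb] at h
  rw [← h]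
  have hz : 2 ≤ 2 ^ (a * b) := Nat.le_self_pow (by positivity) 2
  generalize 2 ^ (a * b) = z at *
  have h2 (c : ℕ) (hc : 0 < c) : 2 ≤ z ^ c := hz.trans (Nat.le_self_pow hc.ne' z)
  rw [← Nat.geomSum_eq (h2 a ha), ← Nat.geomSum_eq (h2 b hb), sum_product, mul_sum, sum_mul_sum]
  congr 2
  refine sum_congr rfl fun i _ => sum_congr rfl fun j _ => ?_
  rw [← pow_mul, ← pow_mul, ← pow_add, ← pow_add]
  congr 1
  ring

theorem IsTerm.gcd {f g : ℕ → ℕ} (hf : IsTerm f) (hg : IsTerm g) (hf0 : ∀ n, 0 < f n)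
    (hg0 : ∀ n, 0 < g n) : IsTerm fun n => Nat.gcd (f n) (g n) := by
  have hz := (hf.mul hg).two_pow
  have h1 := (((hz.pow hf).pow hg).sub (const 1)).div ((hz.pow hf).sub (const 1))
  have h2 := (((hz.pow hg).pow hf).sub (const 1)).div ((hz.pow hg).sub (const 1))
  convert ((h1.mul ((hz.pow hg).mul h2)).div (hz.pow (hf.mul hg))).mod hz using 2 with n
  exact (geom_sum_mul_div_mod_eq_gcd _ _ (hf0 n) (hg0 n)).symm

/-! ### Counting binary ones -/

/-- Recovering `v` from `2 ^ v`, given an upper bound `L`: modulo `N ^ 2`, where `N = 2 ^ L - 1`,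
the power `(2 ^ v) ^ L = (1 + N) ^ v` is `1 + v N`. -/
theorem two_pow_pow_mod_div (v L : ℕ) (hv : v < L) :
    ((2 ^ v) ^ L % (2 ^ L - 1) ^ 2 - 1) / (2 ^ L - 1) = v := by
  obtain ⟨N, hN⟩ : ∃ N, 2 ^ L = N + 1 := ⟨2 ^ L - 1, by have := Nat.one_le_two_pow (n := L); omega⟩
  have hL : L < 2 ^ L := Nat.lt_two_pow_self
  have hvN : v + 1 ≤ N := by omega
  have h1 : (N + 1) ^ v ≡ 1 + v * N [MOD N ^ 2] := by
    clear hv hvN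
    induction v with
    | zero => simp [Nat.ModEq]
    | succ v ih =>
      rw [pow_succ]
      refine (ih.mul_right _).trans ?_
      have : (1 + v * N) * (N + 1) = 1 + (v + 1) * N + N ^ 2 * v := by ring
      rw [this]
      simp [Nat.ModEq]
  -- for `L = 1` the modulus is `1` and the remainder `0`, which is harmless since then `v = 0`
  have h2 : 1 + v * N < N ^ 2 ∨ N = 1 := by
    rcases Nat.lt_or_ge 1 N with h | h
    · left; nlinarith
    · right; omega
  rw [← pow_mul, mul_comm, pow_mul, hN, Nat.add_sub_cancel]
  rcases h2 with h2 | rfl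
  · rw [h1, Nat.mod_eq_of_lt h2, Nat.add_sub_cancel_left, Nat.mul_div_cancel _ (by omega)]
  · have : v = 0 := by omega
    simp [this]

/-- The number of ones in the binary expansion of `m`. -/
def popcount (m : ℕ) : ℕ := (Nat.digits 2 m).sum

@[simp] theorem popcount_zero : popcount 0 = 0 := by simp [popcount]

theorem popcount_add_two_mul (r m : ℕ) (hr : r < 2) : popcount (r + 2 * m) = r + popcount m := by
  rcases Nat.eq_zero_or_pos (r + 2 * m) with h | h
  · obtain ⟨rfl, rfl⟩ : r = 0 ∧ m = 0 := by omega
    simp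
  · rw [popcount, Nat.digits_add 2 (by omega) r m hr (by omega), List.sum_cons, popcount]

/-- Kummer's theorem for the central binomial coefficient. -/
theorem padicValNat_choose_two_mul (m : ℕ) : padicValNat 2 ((2 * m).choose m) = popcount m := by
  have h := sub_one_mul_padicValNat_choose_eq_sub_sum_digits (p := 2) (show m ≤ 2 * m by omega)
  have h2 := popcount_add_two_mul 0 m (by omega)
  have e : 2 * m - m = m := by omega
  simp only [popcount, zero_add] at h2
  rw [e, h2] at h
  simpa [popcount] using h

/-- The power of `2` in the factorization of `X`; the exponent `X` is large enough. -/
theorem gcd_two_pow_eq {X : ℕ} (hX : 0 < X) : Nat.gcd X (2 ^ X) = 2 ^ padicValNat 2 X := by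
  obtain ⟨k, hk, h⟩ := (Nat.dvd_prime_pow Nat.prime_two).1 (Nat.gcd_dvd_right X (2 ^ X))
  rw [h]
  congr 1
  refine le_antisymm ?_ ?_
  · exact (padicValNat_dvd_iff_le hX.ne').1 (h ▸ Nat.gcd_dvd_left X (2 ^ X))
  · have h1 : padicValNat 2 X < X := Nat.padicValNat_lt_self hX.ne'
    have := Nat.dvd_gcd (pow_padicValNat_dvd (p := 2) (n := X)) (pow_dvd_pow 2 h1.le)
    rw [h] at this
    exact (Nat.pow_dvd_pow_iff_le_right (by omega)).1 this

theorem IsTerm.popcount {f : ℕ → ℕ} (hf : IsTerm f) : IsTerm fun n => popcount (f n) := by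
  have hX := ((const 2).mul hf).choose hf
  have hX0 (n : ℕ) : 0 < (2 * f n).choose (f n) := Nat.choose_pos (by omega)
  have hN := hX.two_pow.sub (const 1)
  convert ((((hX.gcd hX.two_pow hX0 fun n => by positivity).pow hX).mod (hN.pow_const 2)).sub
    (const 1)).div hN using 2 with n
  rw [gcd_two_pow_eq (hX0 n), padicValNat_choose_two_mul, two_pow_pow_mod_div]
  rw [← padicValNat_choose_two_mul]
  exact Nat.padicValNat_lt_self (hX0 n).ne'

theorem popcount_add_two_pow_mul (u a b : ℕ) (ha : a < 2 ^ u) :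
    popcount (a + 2 ^ u * b) = popcount a + popcount b := by
  induction u generalizing a with
  | zero =>
    obtain rfl : a = 0 := by simpa using ha
    simp
  | succ u ih =>
    have h1 : a / 2 < 2 ^ u := by rw [pow_succ] at ha; omega
    have h2 : a + 2 ^ (u + 1) * b = a % 2 + 2 * (a / 2 + 2 ^ u * b) := by
      conv_lhs => rw [← Nat.mod_add_div a 2]
      ring
    have h3 := popcount_add_two_mul (a % 2) (a / 2) (Nat.mod_lt _ (by omega))
    rw [Nat.mod_add_div] at h3
    rw [h2, popcount_add_two_mul _ _ (Nat.mod_lt _ (by omega)), ih _ h1, h3, add_assoc]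

/-- The binary complement of a `u`-digit number exchanges zeros and ones. -/
theorem popcount_add_popcount_compl (u a : ℕ) (ha : a < 2 ^ u) :
    popcount a + popcount (2 ^ u - 1 - a) = u := by
  induction u generalizing a with
  | zero =>
    obtain rfl : a = 0 := by simpa using ha
    simp
  | succ u ih =>
    have h1 : a / 2 < 2 ^ u := by rw [pow_succ] at ha; omega
    have h2 : 2 ^ (u + 1) - 1 - a = (1 - a % 2) + 2 * (2 ^ u - 1 - a / 2) := by
      rw [pow_succ] at ha ⊢
      omega
    have h3 := popcount_add_two_mul (a % 2) (a / 2) (Nat.mod_lt _ (by omega))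
    rw [Nat.mod_add_div] at h3
    rw [h2, popcount_add_two_mul _ _ (by omega), h3]
    have := ih _ h1
    omega

/-! ### Counting nonzero digits of packed sequences -/

/-- A zero test by counting ones: for `1 ≤ v ≤ 2 ^ u` the binary expansion of `v (2 ^ u - 1)`
consists of that of `v - 1` followed by the complement of that of `v - 1`. -/
theorem popcount_mul_two_pow_sub_one (u v : ℕ) (hv : v ≤ 2 ^ u) :
    popcount (v * (2 ^ u - 1)) = if v = 0 then 0 else u := by
  rcases Nat.eq_zero_or_pos v with rfl | h
  · simp
  · obtain ⟨w, rfl⟩ : ∃ w, v = w + 1 := ⟨v - 1, by omega⟩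
    have h1 : (w + 1) * (2 ^ u - 1) = (2 ^ u - 1 - w) + 2 ^ u * w := by
      obtain ⟨r, hr⟩ := Nat.exists_eq_add_of_le hv
      have e1 : 2 ^ u - 1 = w + r := by omega
      have e2 : w + r - w = r := by omega
      rw [e1, e2, hr]
      ring
    rw [h1, popcount_add_two_pow_mul _ _ _ (by omega), if_neg (by omega), add_comm,
      popcount_add_popcount_compl _ _ (by omega)]

/-- The blocks `v t * (2 ^ u - 1)` have at most `2 * u` binary digits, so they do not overlap, and
each nonzero `v t` contributes exactly `u` ones. -/
theorem popcount_sum_mul (u T : ℕ) (v : ℕ → ℕ) (hv : ∀ t < T, v t ≤ 2 ^ u) :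
    popcount ((∑ t ∈ range T, v t * 2 ^ (2 * u * t)) * (2 ^ u - 1)) =
      u * #{t ∈ range T | v t ≠ 0} := by
  induction T generalizing v with
  | zero => simp
  | succ T ih =>
    have h1 : (∑ t ∈ range (T + 1), v t * 2 ^ (2 * u * t)) * (2 ^ u - 1) = v 0 * (2 ^ u - 1) +
        2 ^ (2 * u) * ((∑ t ∈ range T, v (t + 1) * 2 ^ (2 * u * t)) * (2 ^ u - 1)) := by
      rw [sum_range_succ', add_mul, add_comm, ← mul_assoc, mul_sum]
      simp only [mul_zero, pow_zero, mul_one]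
      congr 2
      refine sum_congr rfl fun t _ => ?_
      ring
    have h2 : v 0 * (2 ^ u - 1) < 2 ^ (2 * u) := by
      have h3 := Nat.one_le_two_pow (n := u)
      calc v 0 * (2 ^ u - 1) ≤ 2 ^ u * (2 ^ u - 1) := Nat.mul_le_mul_right _ (hv 0 (by omega))
        _ < 2 ^ u * 2 ^ u := Nat.mul_lt_mul_of_pos_left (by omega) (by omega)
        _ = 2 ^ (2 * u) := by ring
    rw [h1, popcount_add_two_pow_mul _ _ _ h2, ih _ fun t ht => hv _ (by omega),
      popcount_mul_two_pow_sub_one _ _ (hv 0 (by omega)), card_filter, card_filter,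
      sum_range_succ']
    split_ifs <;> simp_all
    ring

/-! ### Exponential polynomials and their zeros in a box -/

/-- Summation by parts for `∑ x ^ e * r ^ x`, starting from
`(x + 1) ^ e * r ^ (x + 1) - x ^ e * r ^ x`. -/
theorem sum_range_pow_mul_pow (r e M : ℕ) (hr : 1 ≤ r) :
    (r - 1) * ∑ x ∈ range M, x ^ e * r ^ x + r * ∑ j ∈ range e, e.choose j *
      ∑ x ∈ range M, x ^ j * r ^ x + 0 ^ e = M ^ e * r ^ M := by
  obtain ⟨q, rfl⟩ : ∃ q, r = q + 1 := ⟨r - 1, by omega⟩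
  induction M with
  | zero => simp
  | succ M ih =>
    have h : (M + 1) ^ e = ∑ j ∈ range e, e.choose j * M ^ j + M ^ e := by
      rw [add_pow, sum_range_succ]
      simp [mul_comm]
    simp only [sum_range_succ, mul_add, sum_add_distrib, Nat.add_sub_cancel] at ih ⊢
    have h2 : ∑ j ∈ range e, e.choose j * (M ^ j * (q + 1) ^ M) =
        (∑ j ∈ range e, e.choose j * M ^ j) * (q + 1) ^ M := by
      rw [sum_mul]
      exact sum_congr rfl fun _ _ => by ring
    rw [h, h2, pow_succ, add_mul]
    linear_combination ih

theorem IsTerm.sum_range_pow_mul_two_pow {s M : ℕ → ℕ} (hs : IsTerm s) (hM : IsTerm M)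
    (hs0 : ∀ n, 1 ≤ s n) (e : ℕ) : IsTerm fun n => ∑ x ∈ range (M n), x ^ e * (2 ^ s n) ^ x := by
  induction e using Nat.strong_induction_on with
  | _ e ih =>
    have h1 : IsTerm fun n => ∑ j ∈ range e, e.choose j *
        ∑ x ∈ range (M n), x ^ j * (2 ^ s n) ^ x :=
      IsTerm.sum _ fun j hj => (const _).mul (ih j (mem_range.1 hj))
    have h2 := ((((hM.pow_const e).mul (hs.two_pow.pow hM)).sub (const (0 ^ e))).sub
      (hs.two_pow.mul h1)).div (hs.two_pow.sub (const 1))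
    convert h2 using 2 with n
    have h3 : 2 ≤ 2 ^ s n := Nat.le_self_pow (by have := hs0 n; omega) 2
    rw [← sum_range_pow_mul_pow (2 ^ s n) e (M n) (by omega), Nat.add_sub_cancel,
      Nat.add_sub_cancel, Nat.mul_div_cancel_left _ (by omega)]

/-- The integer-valued functions that are differences of two functions computed by terms. -/
def IsIntTerm (f : ℕ → ℤ) : Prop :=
  ∃ a b : ℕ → ℕ, IsTerm a ∧ IsTerm b ∧ ∀ n, f n = a n - b n

namespace IsIntTerm

theorem natCast {a : ℕ → ℕ} (ha : IsTerm a) : IsIntTerm fun n => (a n : ℤ) :=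
  ⟨a, fun _ => 0, ha, .const 0, fun n => by simp⟩

theorem add {f g : ℕ → ℤ} (hf : IsIntTerm f) (hg : IsIntTerm g) :
    IsIntTerm fun n => f n + g n := by
  obtain ⟨a, b, ha, hb, hf⟩ := hf
  obtain ⟨c, d, hc, hd, hg⟩ := hg
  exact ⟨_, _, ha.add hc, hb.add hd, fun n => by simp only [hf, hg]; push_cast; ring⟩

theorem neg {f : ℕ → ℤ} (hf : IsIntTerm f) : IsIntTerm fun n => -f n := by
  obtain ⟨a, b, ha, hb, hf⟩ := hf
  exact ⟨_, _, hb, ha, fun n => by simp only [hf]; ring⟩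

theorem mul {f g : ℕ → ℤ} (hf : IsIntTerm f) (hg : IsIntTerm g) :
    IsIntTerm fun n => f n * g n := by
  obtain ⟨a, b, ha, hb, hf⟩ := hf
  obtain ⟨c, d, hc, hd, hg⟩ := hg
  exact ⟨_, _, (ha.mul hc).add (hb.mul hd), (ha.mul hd).add (hb.mul hc), fun n => by
    simp only [hf, hg]; push_cast; ring⟩

theorem toNat {f : ℕ → ℤ} (hf : IsIntTerm f) : IsTerm fun n => (f n).toNat := by
  obtain ⟨a, b, ha, hb, hf⟩ := hf
  convert ha.sub hb using 2 with n
  rw [hf]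
  omega

end IsIntTerm

/-- Exponential polynomials in the variables `x i`, with coefficients and exponents depending on a
parameter `n` through terms: the sums of functions `c n * ∏ i, x i ^ e i * 2 ^ (s i n * x i)`. -/
inductive IsExpPoly {k : ℕ} : (ℕ → (Fin k → ℕ) → ℤ) → Prop
  | monomial {c : ℕ → ℤ} (hc : IsIntTerm c) (e : Fin k → ℕ) {s : Fin k → ℕ → ℕ}
      (hs : ∀ i, IsTerm (s i)) :
      IsExpPoly fun n x => c n * ∏ i, ((x i : ℤ) ^ e i * (2 ^ s i n) ^ x i)
  | add {f g : ℕ → (Fin k → ℕ) → ℤ} (hf : IsExpPoly f) (hg : IsExpPoly g) :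
      IsExpPoly fun n x => f n x + g n x

namespace IsExpPoly

variable {k : ℕ} {f g : ℕ → (Fin k → ℕ) → ℤ}

theorem coeff {c : ℕ → ℤ} (hc : IsIntTerm c) : IsExpPoly fun n (_ : Fin k → ℕ) => c n := by
  simpa using monomial (k := k) hc (fun _ => 0) (s := fun _ _ => 0) fun _ => .const 0

theorem const (c : ℕ) : IsExpPoly fun _ (_ : Fin k → ℕ) => (c : ℤ) :=
  coeff (.natCast (.const c))

theorem var (i : Fin k) : IsExpPoly fun _ (x : Fin k → ℕ) => (x i : ℤ) := by
  have h := monomial (k := k) (.natCast (.const 1)) (Pi.single i 1) (s := fun _ _ => 0)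
    fun _ => .const 0
  convert h using 3 with n x
  rw [Finset.prod_eq_single i (by simp +contextual) (by simp)]
  simp

theorem two_pow {s : ℕ → ℕ} (hs : IsTerm s) (i : Fin k) :
    IsExpPoly fun n (x : Fin k → ℕ) => (2 ^ s n : ℤ) ^ x i := by
  have h := monomial (k := k) (.natCast (.const 1)) (fun _ => 0)
    (s := fun j => if j = i then s else fun _ => 0) fun j => by
      split_ifs
      exacts [hs, .const 0]
  convert h using 3 with n x
  rw [Finset.prod_eq_single i (by simp +contextual) (by simp)]
  simp

theorem mul (hf : IsExpPoly f) (hg : IsExpPoly g) : IsExpPoly fun n x => f n x * g n x := by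
  induction hf with
  | add _ _ ih₁ ih₂ => simpa only [add_mul] using ih₁.add ih₂
  | monomial hc e hs =>
    induction hg with
    | add _ _ ih₁ ih₂ => simpa only [mul_add] using ih₁.add ih₂
    | monomial hd e' hs' =>
      convert monomial (hc.mul hd) (fun i => e i + e' i) (fun i => (hs i).add (hs' i)) using 3
        with n x
      rw [mul_mul_mul_comm, ← Finset.prod_mul_distrib]
      congr 1
      refine Finset.prod_congr rfl fun i _ => ?_
      rw [pow_add, pow_add, mul_pow]
      ring

theorem neg (hf : IsExpPoly f) : IsExpPoly fun n x => -f n x := by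
  simpa using (coeff (k := k) (IsIntTerm.natCast (.const 1)).neg).mul hf

theorem sub (hf : IsExpPoly f) (hg : IsExpPoly g) : IsExpPoly fun n x => f n x - g n x := by
  simpa only [sub_eq_add_neg] using hf.add hg.neg

theorem pow (hf : IsExpPoly f) (m : ℕ) : IsExpPoly fun n x => f n x ^ m := by
  induction m with
  | zero => simpa using const (k := k) 1
  | succ m ih => simpa only [pow_succ] using ih.mul hf

/-- The sum of a monomial over a box factors into one-dimensional sums. The weights, which have
base at least `2`, keep the geometric sums away from ratio `1`. -/
theorem isIntTerm_sum (hf : IsExpPoly f) {M : ℕ → ℕ} (hM : IsTerm M) {w : Fin k → ℕ → ℕ}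
    (hw : ∀ i, IsTerm (w i)) (hw0 : ∀ i n, 1 ≤ w i n) :
    IsIntTerm fun n => ∑ x : Fin k → Fin (M n),
      f n (fun i => x i) * ∏ i, (2 ^ w i n : ℤ) ^ (x i : ℕ) := by
  induction hf with
  | add _ _ ih₁ ih₂ => simpa only [add_mul, Finset.sum_add_distrib] using ih₁.add ih₂
  | @monomial c hc e s hs =>
    have h1 (i : Fin k) := IsTerm.sum_range_pow_mul_two_pow ((hs i).add (hw i)) hM
      (fun n => by have := hw0 i n; omega) (e i)
    convert hc.mul (.natCast (IsTerm.prod univ fun i _ => h1 i)) using 2 with n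
    push_cast
    simp only [Finset.sum_range]
    rw [Finset.prod_univ_sum, Fintype.piFinset_univ, Finset.mul_sum]
    refine Finset.sum_congr rfl fun x _ => ?_
    rw [mul_assoc, ← Finset.prod_mul_distrib]
    congr 1
    refine Finset.prod_congr rfl fun i _ => ?_
    rw [pow_add, mul_pow, mul_assoc]

theorem exists_isTerm_bound (hf : IsExpPoly f) {M : ℕ → ℕ} (hM : IsTerm M) :
    ∃ B : ℕ → ℕ, IsTerm B ∧ ∀ n x, (∀ i, x i < M n) → f n x ≤ B n := by
  suffices ∃ B : ℕ → ℕ, IsTerm B ∧ ∀ n x, (∀ i, x i < M n) → |f n x| ≤ B n by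
    obtain ⟨B, hB, h⟩ := this
    exact ⟨B, hB, fun n x hx => (le_abs_self _).trans (h n x hx)⟩
  induction hf with
  | add _ _ ih₁ ih₂ =>
    obtain ⟨B, hB, h⟩ := ih₁
    obtain ⟨C, hC, h'⟩ := ih₂
    refine ⟨_, hB.add hC, fun n x hx => (abs_add_le _ _).trans ?_⟩
    push_cast
    exact add_le_add (h n x hx) (h' n x hx)
  | @monomial c hc e s hs =>
    obtain ⟨a, b, ha, hb, hab⟩ := hc
    refine ⟨_, (ha.add hb).mul (IsTerm.prod univ fun i _ =>
      (hM.pow_const (e i)).mul ((hs i).two_pow.pow hM)), fun n x hx => ?_⟩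
    rw [abs_mul, Finset.abs_prod]
    push_cast
    refine mul_le_mul ?_ (Finset.prod_le_prod (fun _ _ => abs_nonneg _) fun i _ => ?_)
      (Finset.prod_nonneg fun _ _ => abs_nonneg _) (by positivity)
    · rw [hab, abs_le]
      constructor <;> linarith [Int.natCast_nonneg (a n), Int.natCast_nonneg (b n)]
    · rw [abs_of_nonneg (by positivity)]
      have h1 : (x i : ℤ) ≤ M n := by exact_mod_cast (hx i).le
      have h2 : x i ≤ M n := (hx i).le
      gcongr
      exact_mod_cast Nat.one_le_two_pow

/-- The number of zeros of a nonnegative exponential polynomial in a box is computed by a term: the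
values are packed into the digits of a single number, whose nonzero digits are then counted. -/
theorem isTerm_card_zeros (hf : IsExpPoly f) (hf0 : ∀ n x, 0 ≤ f n x) {M : ℕ → ℕ} (hM : IsTerm M)
    (hM0 : ∀ n, 0 < M n) :
    IsTerm fun n => #{x : Fin k → Fin (M n) | f n (fun i => x i) = 0} := by
  obtain ⟨B, hB, hfB⟩ := hf.exists_isTerm_bound hM
  have hu := hB.add (.const 1)
  have hw (i : Fin k) := ((IsTerm.const 2).mul hu).mul (hM.pow_const i)
  have hsum := hf.isIntTerm_sum hM hw fun i n =>
    Nat.succ_le_of_lt (Nat.mul_pos (by omega) (Nat.pow_pos (hM0 n)))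
  convert (hM.pow_const k).sub
    ((hsum.toNat.mul (hu.two_pow.sub (.const 1))).popcount.div hu) using 2 with n
  set u := B n + 1 with hu_def
  -- `v t` is the value of `f n` at the point whose coordinates are the base-`M n` digits of `t`
  let v : ℕ → ℕ := fun t => if h : t < M n ^ k then
    (f n fun i => finFunctionFinEquiv.symm ⟨t, h⟩ i).toNat else 0
  have hv (x : Fin k → Fin (M n)) : v (finFunctionFinEquiv x) = (f n fun i => x i).toNat := by
    simp only [v, Fin.is_lt, dite_true, Fin.eta, Equiv.symm_apply_apply]
  have hvu : ∀ t < M n ^ k, v t ≤ 2 ^ u := by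
    intro t ht
    have h1 := hfB n (fun i => finFunctionFinEquiv.symm ⟨t, ht⟩ i) fun i => Fin.is_lt _
    have h2 : B n < 2 ^ B n := Nat.lt_two_pow_self
    have h3 : 2 ^ B n ≤ 2 ^ u := Nat.pow_le_pow_right (by omega) (by omega)
    simp only [v, dif_pos ht]
    omega
  have h1 : (∑ x : Fin k → Fin (M n), f n (fun i => x i) *
      ∏ i : Fin k, (2 ^ (2 * u * M n ^ (i : ℕ)) : ℤ) ^ (x i : ℕ)).toNat =
      ∑ t ∈ range (M n ^ k), v t * 2 ^ (2 * u * t) := by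
    rw [Finset.sum_range, ← finFunctionFinEquiv.sum_comp]
    zify
    rw [Int.toNat_of_nonneg (Finset.sum_nonneg fun x _ => mul_nonneg (hf0 n _) (by positivity))]
    refine Finset.sum_congr rfl fun x _ => ?_
    rw [hv, Int.toNat_of_nonneg (hf0 n _), finFunctionFinEquiv_apply, Finset.mul_sum,
      ← Finset.prod_pow_eq_pow_sum]
    congr 1
    refine Finset.prod_congr rfl fun i _ => ?_
    rw [← pow_mul]
    congr 1
    ring
  have h2 : #{t ∈ range (M n ^ k) | v t ≠ 0} =
      #{x : Fin k → Fin (M n) | f n (fun i => x i) ≠ 0} := by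
    rw [Finset.card_filter, Finset.card_filter, Finset.sum_range, ← finFunctionFinEquiv.sum_comp]
    refine Finset.sum_congr rfl fun x _ => ?_
    rw [hv]
    have := hf0 n fun i => x i
    congr 1
    simp only [ne_eq, eq_iff_iff]
    omega
  have h3 := Finset.card_filter_add_card_filter_not (s := (univ : Finset (Fin k → Fin (M n))))
    (fun x => f n (fun i => x i) = 0)
  rw [h1, popcount_sum_mul _ _ _ hvu, h2, Nat.mul_div_cancel_left _ (by omega)]
  simp only [Finset.card_univ, Fintype.card_fun, Fintype.card_fin] at h3
  simp only [ne_eq]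
  omega

end IsExpPoly

/-! ### Twin primes -/

/-- The pairs `(a, b)` that witness that `p` or `p + 2` has a factorization `(a + 2) * (b + 2)` into
two factors greater than `1`. For `2 ≤ p ≤ n` there is none exactly if `p` and `p + 2` are prime. -/
def factorizations (n p : ℕ) : Finset (ℕ × ℕ) :=
  {q ∈ range (n + 1) ×ˢ range (n + 1) |
    (q.1 + 2) * (q.2 + 2) = p ∨ (q.1 + 2) * (q.2 + 2) = p + 2}

theorem prime_iff_forall_add_two_mul_add_two_ne {m : ℕ} (hm : 2 ≤ m) :
    m.Prime ↔ ∀ a b : ℕ, (a + 2) * (b + 2) ≠ m := by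
  constructor
  · rintro h a b rfl
    exact Nat.not_prime_mul (by omega) (by omega) h
  · intro h
    by_contra hp
    obtain ⟨a, b, ha, hb, rfl⟩ := (Nat.not_prime_iff_exists_mul_eq hm).1 hp
    have ha2 : 2 ≤ a := by
      by_contra h
      interval_cases a <;> omega
    have hb2 : 2 ≤ b := by
      by_contra h
      interval_cases b <;> omega
    exact h (a - 2) (b - 2) (by rw [Nat.sub_add_cancel ha2, Nat.sub_add_cancel hb2])

theorem factorizations_eq_empty_iff {n p : ℕ} (hp : p ≤ n) :
    factorizations n p = ∅ ↔ (p.Prime ∧ (p + 2).Prime) ∨ p < 2 := by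
  have key : factorizations n p = ∅ ↔
      ∀ a b : ℕ, (a + 2) * (b + 2) ≠ p ∧ (a + 2) * (b + 2) ≠ p + 2 := by
    simp only [factorizations, filter_eq_empty_iff, mem_product, mem_range, Prod.forall, not_or]
    refine ⟨fun h a b => ?_, fun h a b _ => h a b⟩
    by_contra hab
    have : (a + 2) * (b + 2) ≤ n + 2 := by omega
    exact hab (h a b ⟨by nlinarith, by nlinarith⟩)
  rw [key]
  rcases Nat.lt_or_ge p 2 with h2 | h2
  · simp only [h2, or_true, iff_true]
    intro a b
    have : 4 ≤ (a + 2) * (b + 2) := by nlinarith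
    omega
  · rw [prime_iff_forall_add_two_mul_add_two_ne h2,
      prime_iff_forall_add_two_mul_add_two_ne (by omega : 2 ≤ p + 2)]
    simp only [forall_and, h2.not_gt, or_false]

theorem card_factorizations_le (n p : ℕ) : #(factorizations n p) ≤ 2 ^ (2 * n + 1) := by
  calc #(factorizations n p) ≤ #(range (n + 1) ×ˢ range (n + 1)) := card_filter_le _ _
    _ = (n + 1) * (n + 1) := by simp
    _ ≤ 2 ^ n * 2 ^ n := Nat.mul_le_mul Nat.lt_two_pow_self Nat.lt_two_pow_self
    _ = 2 ^ (2 * n) := by ring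
    _ ≤ 2 ^ (2 * n + 1) := Nat.pow_le_pow_right (by omega) (by omega)

/-- The polynomial in `a, b, p, j, s = x 0, …, x 4` that vanishes if and only if `(a + 2) * (b + 2)`
is `p` or `p + 2` and `j + s + 1 = z ^ p`, where `z = 2 ^ (2 * (2 * n + 1))`. The variable `s` is
the slack in `j < z ^ p`. -/
def witnessPoly (n : ℕ) (x : Fin 5 → ℕ) : ℤ :=
  (((x 0 + 2) * (x 1 + 2) - x 2) * ((x 0 + 2) * (x 1 + 2) - (x 2 + 2))) ^ 2 +
    (x 3 + x 4 + 1 - (2 ^ (2 * (2 * n + 1))) ^ x 2) ^ 2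

theorem isTerm_two_mul_add_one : IsTerm fun n => 2 * n + 1 :=
  ((IsTerm.const 2).mul .id).add (.const 1)

theorem isExpPoly_witnessPoly : IsExpPoly witnessPoly := by
  have hA := ((IsExpPoly.var (k := 5) 0).add (.const 2)).mul ((IsExpPoly.var 1).add (.const 2))
  have hz := IsExpPoly.two_pow (k := 5) ((IsTerm.const 2).mul isTerm_two_mul_add_one) 2
  exact (((hA.sub (.var 2)).mul (hA.sub ((IsExpPoly.var 2).add (.const 2)))).pow 2).add
    (((((IsExpPoly.var 3).add (.var 4)).add (.const 1)).sub hz).pow 2)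

theorem witnessPoly_eq_zero_iff (n : ℕ) (x : Fin 5 → ℕ) : witnessPoly n x = 0 ↔
    ((x 0 + 2) * (x 1 + 2) = x 2 ∨ (x 0 + 2) * (x 1 + 2) = x 2 + 2) ∧
      x 3 + x 4 + 1 = (2 ^ (2 * (2 * n + 1))) ^ x 2 := by
  rw [witnessPoly, add_eq_zero_iff_of_nonneg (sq_nonneg _) (sq_nonneg _), sq_eq_zero_iff,
    sq_eq_zero_iff, mul_eq_zero, sub_eq_zero, sub_eq_zero, sub_eq_zero]
  norm_cast

/-- Since the pair `(j, s)` can be chosen in `z ^ p` ways and the side of the box is `z ^ n`, the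
zeros of `witnessPoly` enumerate each factorization for `p ≤ n` with multiplicity `z ^ p`. -/
theorem card_witnessPoly_zeros (n : ℕ) :
    #{x : Fin 5 → Fin ((2 ^ (2 * (2 * n + 1))) ^ n) | witnessPoly n (fun i => x i) = 0} =
      ∑ p ∈ range (n + 1), #(factorizations n p) * 2 ^ (2 * (2 * n + 1) * p) := by
  have hz2 : 2 ≤ 2 ^ (2 * (2 * n + 1)) := Nat.le_self_pow (by omega) 2
  simp only [witnessPoly_eq_zero_iff, pow_mul _ (2 * (2 * n + 1))]
  generalize 2 ^ (2 * (2 * n + 1)) = z at *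
  have hn : n < z ^ n := Nat.lt_pow_self hz2
  have h1 : ∑ p ∈ range (n + 1), #(factorizations n p) * z ^ p =
      #((range (n + 1)).sigma fun p => factorizations n p ×ˢ range (z ^ p)) := by
    simp
  rw [h1]
  refine card_bij (fun x _ => ⟨x 2, ((x 0, x 1), x 3)⟩) ?_ ?_ ?_
  · intro x hx
    simp only [mem_filter, mem_univ, true_and] at hx
    obtain ⟨hx, hj⟩ := hx
    have h3 := (x 3).is_lt
    have h4 := (x 4).is_lt
    have hp : (x 2 : ℕ) < n + 1 := by
      refine (Nat.pow_lt_pow_iff_right hz2).1 ?_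
      rw [← hj, pow_succ]
      nlinarith
    have hle : ((x 0 : ℕ) + 2) * (x 1 + 2) ≤ n + 2 := by omega
    simp only [factorizations, mem_sigma, mem_product, mem_filter, mem_range]
    exact ⟨hp, ⟨⟨by nlinarith, by nlinarith⟩, hx⟩, by omega⟩
  · intro x hx y hy hxy
    simp only [mem_filter, mem_univ, true_and] at hx hy
    have hx4 := hx.2
    have hy4 := hy.2
    simp only [Sigma.mk.injEq, heq_eq_eq, Prod.mk.injEq] at hxy
    obtain ⟨h2, ⟨h0, h1⟩, h3⟩ := hxy
    rw [h2, h3] at hx4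
    have h4 : x 4 = y 4 := Fin.ext (by omega)
    ext i
    fin_cases i
    exacts [h0, h1, h2, h3, congrArg _ h4]
  · rintro ⟨p, ⟨⟨a, b⟩, j⟩⟩ h
    simp only [factorizations, mem_sigma, mem_product, mem_filter, mem_range] at h
    obtain ⟨hp, ⟨-, hab⟩, hj⟩ := h
    have hpow : z ^ p ≤ z ^ n := Nat.pow_le_pow_right (by omega) (by omega)
    have hle : (a + 2) * (b + 2) ≤ n + 2 := by omega
    have ha : a < n := by nlinarith
    have hb : b < n := by nlinarith
    refine ⟨![⟨a, by omega⟩, ⟨b, by omega⟩, ⟨p, by omega⟩, ⟨j, by omega⟩,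
      ⟨z ^ p - 1 - j, by omega⟩], ?_, by simp⟩
    simp only [mem_filter, mem_univ, true_and]
    exact ⟨hab, show j + (z ^ p - 1 - j) + 1 = z ^ p by omega⟩

/-- The twin primes up to `n` are the `p ≤ n` without factorizations, less the exceptional values
`0` and `1`. For `n = 0` only `0` occurs, and the truncated subtraction still gives `0`. -/
theorem card_twin_eq (n : ℕ) :
    #{p ∈ Icc 1 n | p.Prime ∧ (p + 2).Prime} =
      n + 1 - #{p ∈ range (n + 1) | #(factorizations n p) ≠ 0} - 2 := by
  have h1 := card_filter_add_card_filter_not (s := range (n + 1))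
    (fun p => #(factorizations n p) ≠ 0)
  have h2 : {p ∈ range (n + 1) | ¬ #(factorizations n p) ≠ 0} =
      {p ∈ Icc 1 n | p.Prime ∧ (p + 2).Prime} ∪ {p ∈ range (n + 1) | p < 2} := by
    ext p
    simp only [mem_filter, mem_union, mem_range, mem_Icc, not_not, card_eq_zero]
    constructor
    · rintro ⟨hp, h⟩
      rcases (factorizations_eq_empty_iff (by omega)).1 h with h | h
      exacts [.inl ⟨⟨h.1.pos, by omega⟩, h⟩, .inr ⟨hp, h⟩]
    · rintro (⟨hp, h⟩ | ⟨hp, h⟩)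
      exacts [⟨by omega, (factorizations_eq_empty_iff hp.2).2 (.inl h)⟩,
        ⟨hp, (factorizations_eq_empty_iff (by omega)).2 (.inr h)⟩]
  have h3 : Disjoint {p ∈ Icc 1 n | p.Prime ∧ (p + 2).Prime} {p ∈ range (n + 1) | p < 2} := by
    refine disjoint_left.2 fun p hp hp' => ?_
    have := (mem_filter.1 hp).2.1.two_le
    have := (mem_filter.1 hp').2
    omega
  rw [h2, card_union_of_disjoint h3, card_range] at h1
  rcases n with _ | n
  · have h4 : #{p ∈ Icc 1 0 | p.Prime ∧ (p + 2).Prime} = 0 := by simp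
    omega
  · have h4 : {p ∈ range (n + 1 + 1) | p < 2} = range 2 := by
      ext p
      simp only [mem_filter, mem_range]
      omega
    rw [h4, card_range] at h1
    omega

theorem mainTheorem3 :
    ∃ T : ArithTerm 1, ∀ n : ℕ,
      T.DefinedAt (fun _ => n) ∧
      T.eval (fun _ => n) =
        ((Finset.Icc 1 n).filter (fun p : ℕ => p.Prime ∧ (p + 2).Prime)).card := by
  -- digits are at most `2 ^ u` with `u = 2 * n + 1`, and the side of the box is `(2 ^ (2 * u)) ^ n`
  have hu := isTerm_two_mul_add_one
  have hM := ((IsTerm.const 2).mul hu).two_pow.pow .id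
  have hV := isExpPoly_witnessPoly.isTerm_card_zeros
    (fun n x => add_nonneg (sq_nonneg _) (sq_nonneg _)) hM (fun n => by positivity)
  obtain ⟨T, hT⟩ := ((IsTerm.id.add (.const 1)).sub
    ((hV.mul (hu.two_pow.sub (.const 1))).popcount.div hu)).sub (.const 2)
  refine ⟨T, fun n => ⟨(hT n).1, (hT n).2.trans ?_⟩⟩
  simp only [card_twin_eq, card_witnessPoly_zeros]
  rw [popcount_sum_mul _ _ _ fun p _ => card_factorizations_le n p,
    Nat.mul_div_cancel_left _ (by omega)]
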